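/- Let $(R,\mathfrak m)$ be a Cohen-Macaulay (Noetherian) local ring with $\dim R=1$. Let $\mathrm v(R)=\mu_R(\mathfrak m)$ be its embedding dimension, i.e. the number of elements in a minimal system of generators of $\mathfrak m$, and let $\mathrm e(R)=\lim_{n\to\infty}\ell_R(R/\mathfrak m^n)/n$ be its multiplicity, where $\ell_R$ denotes length. An $\mathfrak m$-primary ideal $I$ of $R$ is called an Ulrich ideal if it contains a parameter ideal $Q$ of $R$ (an $\mathfrak m$-primary ideal generated by $\dim R=1$ element) as a reduction (i.e. $I^{n+1}=QI^n$ for some $n\ge 0$) such that $I\neq Q$ and $I^2=QI$, and if $I/I^2$ is a free $R/I$-module. Suppose that $R$ has minimal multiplicity in the sense that $\mathrm v(R)=\mathrm e(R)>1$. Then the set of all Ulrich ideals of $R$ is totally ordered by inclusion: for any two Ulrich ideals $I,J$ of $R$, either $I\subseteq J$ or $J\subseteq I$. -/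

import Mathlib

/-- A Noetherian local ring is Cohen-Macaulay if `depth R = dim R`, i.e. if there is an `R`-regular
sequence (which then automatically lies in the maximal ideal) of length `dim R`. -/
def IsCohenMacaulayLocal (R : Type*) [CommRing R] [IsLocalRing R] : Prop :=
  IsNoetherianRing R ∧ ∃ rs : List R,
    RingTheory.Sequence.IsRegular R rs ∧ ringKrullDim R = (rs.length : WithBot ℕ∞)

/-- `I` is `𝔪`-primary. -/
def Ideal.IsMPrimary {R : Type*} [CommRing R] [IsLocalRing R] (I : Ideal R) : Prop :=
  I.radical = IsLocalRing.maximalIdeal R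

/-- A parameter ideal: an `𝔪`-primary ideal generated by `dim R` elements. -/
def Ideal.IsParameterIdeal {R : Type*} [CommRing R] [IsLocalRing R] (Q : Ideal R) : Prop :=
  Q.IsMPrimary ∧ ∃ (d : ℕ) (a : Fin d → R),
    ringKrullDim R = (d : WithBot ℕ∞) ∧ Q = Ideal.span (Set.range a)

/-- `Q` is a reduction of `I`. -/
def Ideal.IsReductionOf {R : Type*} [CommRing R] (Q I : Ideal R) : Prop :=
  Q ≤ I ∧ ∃ n : ℕ, I ^ (n + 1) = Q * I ^ n

/-- `I` is an Ulrich ideal: it is `𝔪`-primary, contains a parameter ideal `Q` as a reduction,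
`I ≠ Q`, `I ^ 2 = Q I`, and `I / I ^ 2` (in Mathlib: `I.Cotangent`) is a free `R / I`-module. -/
def Ideal.IsUlrich {R : Type*} [CommRing R] [IsLocalRing R] (I : Ideal R) : Prop :=
  I.IsMPrimary ∧
    (∃ Q : Ideal R, Q.IsParameterIdeal ∧ Q.IsReductionOf I ∧ I ≠ Q ∧ I ^ 2 = Q * I) ∧
    Module.Free (R ⧸ I) I.Cotangent

/-- The set of all Ulrich ideals of `R`. -/
def ulrichIdeals (R : Type*) [CommRing R] [IsLocalRing R] : Set (Ideal R) :=
  {I | I.IsUlrich}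

/-- The embedding dimension: the number of elements in a minimal system of generators
of the maximal ideal. -/
noncomputable def embeddingDim (R : Type*) [CommRing R] [IsLocalRing R] : ℕ :=
  (IsLocalRing.maximalIdeal R).spanFinrank

/-- In a one-dimensional Noetherian local ring, `e` is the multiplicity of `R` with respect to the
`𝔪`-primary ideal `𝔞`: `e = lim ℓ(R / 𝔞 ^ n) / n`. All these lengths are finite there. -/
def Ideal.HasMultiplicity {R : Type*} [CommRing R] (𝔞 : Ideal R) (e : ℝ) : Prop :=
  Filter.Tendsto (fun n : ℕ => ((Module.length R (R ⧸ 𝔞 ^ n)).toNat : ℝ) / (n : ℝ))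
    Filter.atTop (nhds e)

/-!
Over the faithfully flat extension `R(X)` of `R`, the maximal ideal `𝔪` has a superficial element
`f`: the generic combination of generators of `𝔪`. Multiplication by `f` makes `μ(𝔪 ^ n)`
eventually nondecreasing, and its averages converge to `e(R) = μ(𝔪)`, so eventually
`μ(𝔪 ^ n) = μ(𝔪)` and `𝔪 ^ (n + 1) = f 𝔪 ^ n`. Counting lengths, `ℓ(R / f) = μ(𝔪)`, hence
`𝔪 ^ 2 = f 𝔪`.

Let `I` be an Ulrich ideal and `a` a generator of its reduction. As `I / I ^ 2` is free and `I`
needs at least two generators, `(a) : I = I`. With `𝔪 ^ 2 = f 𝔪` this gives `𝔪 I ⊆ f I`, then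
`𝔪 = (f) + I`, and `I ^ 2 ⊆ f ^ n I` as long as `f ^ j ∉ I` for all `j < n`.

Let `J` be another Ulrich ideal, and suppose that the least exponent `n` with `f ^ n ∈ I` is at most
the one of `J`. Then `J ⊆ I + (f ^ j)` for all `j ≤ n`, by induction on `j`: write `y ∈ J` as
`i + f ^ j r` with `j < n`. If `r ∈ 𝔪`, use `𝔪 = (f) + I`; if `r` were a unit, comparing
`y ^ 2 ∈ f ^ n J` with `i ^ 2 ∈ f ^ n I` would put `f ^ j` into `I`, contradicting the choice of
`n`. For `j = n` this says `J ⊆ I`.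
-/

open IsLocalRing Filter Polynomial TensorProduct

section Comparison

variable {R : Type*} [CommRing R] [IsLocalRing R] {I J : Ideal R} {x : R} {n : ℕ}

theorem le_of_pow_mem_of_forall_pow_notMem (hx : IsLeftRegular x)
    (hm : maximalIdeal R ≤ Ideal.span {x} ⊔ I) (hxn : x ^ n ∈ I) (hlt : ∀ j < n, x ^ j ∉ I)
    (hI : I ^ 2 ≤ Ideal.span {x ^ n} * I) (hJ : J ^ 2 ≤ Ideal.span {x ^ n} * J) : J ≤ I := by
  suffices h : ∀ j ≤ n, J ≤ I ⊔ Ideal.span {x ^ j} by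
    simpa [(Ideal.span_singleton_le_iff_mem I).2 hxn] using h n le_rfl
  intro j
  induction j with
  | zero => simp
  | succ j ih =>
    intro hj y hy
    obtain ⟨i, hi, r, rfl⟩ : ∃ i ∈ I, ∃ r, i + x ^ j * r = y := by
      simpa [Submodule.mem_sup, Ideal.mem_span_singleton', mul_comm] using ih (by omega) hy
    by_cases hr : r ∈ maximalIdeal R
    · obtain ⟨s, i', hi', rfl⟩ : ∃ s, ∃ i' ∈ I, x * s + i' = r := by
        simpa [Submodule.mem_sup, Ideal.mem_span_singleton', mul_comm] using hm hr
      rw [show i + x ^ j * (x * s + i') = (i + x ^ j * i') + s * x ^ (j + 1) by ring]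
      exact Submodule.add_mem_sup (I.add_mem hi (I.mul_mem_left _ hi'))
        (Ideal.mul_mem_left _ _ (Ideal.mem_span_singleton_self _))
    · refine absurd ?_ (hlt j hj)
      obtain ⟨y, hy, hyJ⟩ := Ideal.mem_span_singleton_mul.1 (hJ (Ideal.pow_mem_pow hy 2))
      obtain ⟨i', hi', r', rfl⟩ : ∃ i' ∈ I, ∃ r', i' + x ^ j * r' = y := by
        simpa [Submodule.mem_sup, Ideal.mem_span_singleton', mul_comm] using ih (by omega) hy
      obtain ⟨i'', hi'', hiI⟩ := Ideal.mem_span_singleton_mul.1 (hI (Ideal.pow_mem_pow hi 2))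
      have hcancel : x ^ j * r ^ 2 = x ^ (n - j) * (i' - i'') + x ^ n * r' - 2 * r * i := by
        refine hx.pow j ?_
        have hpow : x ^ n = x ^ j * x ^ (n - j) := by rw [← pow_add]; congr; omega
        linear_combination -hyJ + hiI + (i' - i'') * hpow
      rw [← Ideal.mul_unit_mem_iff_mem I ((notMem_maximalIdeal.1 hr).pow 2), hcancel]
      exact I.sub_mem (I.add_mem (I.mul_mem_left _ (I.sub_mem hi' hi'')) (I.mul_mem_right _ hxn))
        (I.mul_mem_left _ hi)

end Comparison

section CotangentBasis

variable {R : Type*} [CommRing R]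

/-- The family `u` generates the ideal `I`, and its classes are a basis of `I / I ^ 2` over
`R / I`. Linear independence is spelled out on representatives in `R`. -/
structure IsCotangentBasis {ι : Type*} [Fintype ι] (I : Ideal R) (u : ι → R) : Prop where
  span_range_eq : Ideal.span (Set.range u) = I
  mem_of_sum_mem_sq : ∀ r : ι → R, ∑ i, r i * u i ∈ I ^ 2 → ∀ i, r i ∈ I

namespace IsCotangentBasis

variable {ι : Type*} [Fintype ι] {I : Ideal R} {u : ι → R}

theorem mem (h : IsCotangentBasis I u) (i : ι) : u i ∈ I :=
  h.span_range_eq.le (Ideal.subset_span ⟨i, rfl⟩)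

theorem exists_sum_eq (h : IsCotangentBasis I u) {z : R} (hz : z ∈ I) :
    ∃ r : ι → R, ∑ i, r i * u i = z :=
  Ideal.mem_span_range_iff_exists_fun.1 (h.span_range_eq.ge hz)

theorem ideal_fg (h : IsCotangentBasis I u) : I.FG :=
  Submodule.fg_def.2 ⟨_, Set.finite_range u, h.span_range_eq⟩

theorem sub_mem_of_mul_eq_sum (h : IsCotangentBasis I u) [DecidableEq ι] {i : ι} {b : R}
    {r : ι → R} (hb : b * u i = ∑ j, r j * u j) (j : ι) : (if j = i then b else 0) - r j ∈ I :=
  h.mem_of_sum_mem_sq (fun j ↦ (if j = i then b else 0) - r j)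
    (by simp [sub_mul, Finset.sum_sub_distrib, ite_mul, hb]) j

theorem mem_sup_of_forall_mul_mem [Nonempty ι] (h : IsCotangentBasis I u) {b c : R}
    (hb : ∀ z ∈ I, b * z ∈ Ideal.span {c} * I) : b ∈ Ideal.span {c} ⊔ I := by
  classical
  obtain ⟨i⟩ := ‹Nonempty ι›
  obtain ⟨w, hw, hbw⟩ := Ideal.mem_span_singleton_mul.1 (hb _ (h.mem i))
  obtain ⟨r, rfl⟩ := h.exists_sum_eq hw
  have hmem := h.sub_mem_of_mul_eq_sum (i := i) (b := b) (r := fun j ↦ c * r j)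
    (by simp only [← hbw, Finset.mul_sum, mul_assoc]) i
  rw [if_pos rfl] at hmem
  rw [← add_sub_cancel (c * r i) b]
  exact Submodule.add_mem_sup (Ideal.mul_mem_right _ _ (Ideal.mem_span_singleton_self c)) hmem

theorem mem_of_mul_mem_sq [IsLocalRing R] (h : IsCotangentBasis I u) {c w : R} (hc : c ∉ I)
    (hw : w ∈ I) (hcw : c * w ∈ I ^ 2) : w ∈ maximalIdeal R * I := by
  obtain ⟨r, rfl⟩ := h.exists_sum_eq hw
  refine Ideal.sum_mem _ fun i _ ↦ Ideal.mul_mem_mul ?_ (h.mem i)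
  by_contra hr
  refine hc ((Ideal.mul_unit_mem_iff_mem I (notMem_maximalIdeal.1 hr)).1 ?_)
  exact h.mem_of_sum_mem_sq (fun i ↦ c * r i) (by simpa [Finset.mul_sum, mul_assoc] using hcw) i

end IsCotangentBasis

end CotangentBasis

/-- An ideal `I` of a local ring with a regular element `a ∈ I` such that `I ^ 2 = a I`, `I ≠ (a)`
and `I / I ^ 2` is free over `R / I`: in a one-dimensional Cohen-Macaulay local ring, an Ulrich
ideal together with a generator of a parameter ideal that is a reduction of it. -/
structure IsUlrichPair {R : Type*} [CommRing R] [IsLocalRing R] (I : Ideal R) (a : R) : Prop where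
  le_maximalIdeal : I ≤ maximalIdeal R
  isLeftRegular : IsLeftRegular a
  mem : a ∈ I
  ne_span : I ≠ Ideal.span {a}
  sq_eq : I ^ 2 = Ideal.span {a} * I
  exists_isCotangentBasis : ∃ (n : ℕ) (u : Fin n → R), IsCotangentBasis I u

namespace IsUlrichPair

variable {R : Type*} [CommRing R] [IsLocalRing R] {I : Ideal R} {a : R}

theorem notMem_maximalIdeal_mul (h : IsUlrichPair I a) : a ∉ maximalIdeal R * I := by
  intro ha
  obtain ⟨_, _, hu⟩ := h.exists_isCotangentBasis
  have hle : I ^ 2 ≤ maximalIdeal R • I ^ 2 := by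
    conv_lhs => rw [h.sq_eq]
    rw [smul_eq_mul, sq, ← mul_assoc]
    exact Ideal.mul_mono_left ((Ideal.span_singleton_le_iff_mem _).2 ha)
  have hbot : I ^ 2 = ⊥ := Submodule.eq_bot_of_le_smul_of_le_jacobson_bot _ _
    (hu.ideal_fg.pow) hle (jacobson_eq_maximalIdeal _ bot_ne_top).ge
  have ha2 : a ^ 2 = 0 := (Submodule.mem_bot R).1 (hbot ▸ Ideal.pow_mem_pow h.mem 2)
  exact one_ne_zero (h.isLeftRegular.pow 2 (show a ^ 2 * 1 = a ^ 2 * 0 by simp [ha2]))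

theorem exists_isUnit_coeff (h : IsUlrichPair I a) {ι : Type*} [Fintype ι] {u : ι → R}
    (hu : IsCotangentBasis I u) : ∃ α : ι → R, ∑ i, α i * u i = a ∧ ∃ i, IsUnit (α i) := by
  obtain ⟨α, hα⟩ := hu.exists_sum_eq h.mem
  refine ⟨α, hα, ?_⟩
  by_contra! hnonunit
  refine h.notMem_maximalIdeal_mul (hα ▸ ?_)
  exact Ideal.sum_mem _ fun i _ ↦ Ideal.mul_mem_mul
    ((mem_maximalIdeal _).2 (hnonunit i)) (hu.mem i)

theorem nontrivial_index (h : IsUlrichPair I a) {ι : Type*} [Fintype ι] {u : ι → R}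
    (hu : IsCotangentBasis I u) : Nontrivial ι := by
  obtain ⟨α, hα, i, hi⟩ := h.exists_isUnit_coeff hu
  by_contra hsub
  rw [not_nontrivial_iff_subsingleton] at hsub
  have := uniqueOfSubsingleton i
  refine h.ne_span ?_
  rw [← hα, Fintype.sum_subsingleton _ i, Ideal.span_singleton_mul_left_unit hi,
    ← hu.span_range_eq, Set.range_unique, Subsingleton.elim default i]

theorem mem_of_forall_dvd (h : IsUlrichPair I a) {c : R} (hc : ∀ z ∈ I, a ∣ c * z) : c ∈ I := by
  obtain ⟨_, u, hu⟩ := h.exists_isCotangentBasis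
  obtain ⟨α, hα, i, hi⟩ := h.exists_isUnit_coeff hu
  have := h.nontrivial_index hu
  obtain ⟨j, hj⟩ := exists_ne i
  obtain ⟨s, hs⟩ := hc _ (hu.mem j)
  have hmem := hu.sub_mem_of_mul_eq_sum (i := j) (b := c) (r := fun l ↦ s * α l)
    (by simp only [mul_assoc, ← Finset.mul_sum]; rw [hα, hs, mul_comm])
  have hsI : s ∈ I := by
    have hi_mem := hmem i
    rw [if_neg hj.symm, zero_sub, neg_mem_iff] at hi_mem
    exact (Ideal.mul_unit_mem_iff_mem _ hi).1 hi_mem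
  have hj_mem := hmem j
  rw [if_pos rfl] at hj_mem
  exact (I.sub_mem_iff_left (I.mul_mem_right _ hsI)).1 hj_mem

variable {x : R}

theorem maximalIdeal_mul_le (h : IsUlrichPair I a) (hx : IsLeftRegular x)
    (hm : maximalIdeal R ^ 2 = Ideal.span {x} * maximalIdeal R) :
    maximalIdeal R * I ≤ Ideal.span {x} * I := by
  have hdvd {y z : R} (hy : y ∈ maximalIdeal R) (hz : z ∈ maximalIdeal R) :
      ∃ w ∈ maximalIdeal R, x * w = y * z :=
    Ideal.mem_span_singleton_mul.1 (hm.le (sq (maximalIdeal R) ▸ Ideal.mul_mem_mul hy hz))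
  refine Ideal.mul_le.2 fun b hb z hz ↦ ?_
  -- With `a b = x c`, the element `c` lies in `(a) : 𝔪`, hence in `I`, so `c z ∈ I ^ 2 = a I`.
  obtain ⟨c, -, hc⟩ := hdvd (h.le_maximalIdeal h.mem) hb
  have hcI : c ∈ I := by
    refine h.mem_of_forall_dvd fun y hy ↦ ?_
    obtain ⟨w, -, hw⟩ := hdvd hb (h.le_maximalIdeal hy)
    exact ⟨w, hx (by linear_combination y * hc - a * hw)⟩
  obtain ⟨w, hw, haw⟩ := Ideal.mem_span_singleton_mul.1
    (h.sq_eq.le (sq I ▸ Ideal.mul_mem_mul hcI hz))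
  exact Ideal.mem_span_singleton_mul.2
    ⟨w, hw, h.isLeftRegular (by linear_combination x * haw + z * hc)⟩

theorem maximalIdeal_le_sup (h : IsUlrichPair I a) (hx : IsLeftRegular x)
    (hm : maximalIdeal R ^ 2 = Ideal.span {x} * maximalIdeal R) :
    maximalIdeal R ≤ Ideal.span {x} ⊔ I := by
  obtain ⟨_, _, hu⟩ := h.exists_isCotangentBasis
  have := h.nontrivial_index hu
  exact fun b hb ↦ hu.mem_sup_of_forall_mul_mem fun z hz ↦
    h.maximalIdeal_mul_le hx hm (Ideal.mul_mem_mul hb hz)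

theorem sq_le_span_pow_mul (h : IsUlrichPair I a) (hx : IsLeftRegular x)
    (hm : maximalIdeal R ^ 2 = Ideal.span {x} * maximalIdeal R) {n : ℕ}
    (hn : ∀ j < n, x ^ j ∉ I) : I ^ 2 ≤ Ideal.span {x ^ n} * I := by
  obtain ⟨_, _, hu⟩ := h.exists_isCotangentBasis
  induction n with
  | zero => simpa using Ideal.pow_le_self two_ne_zero
  | succ n ih =>
    intro z hz
    obtain ⟨w, hw, rfl⟩ := Ideal.mem_span_singleton_mul.1 (ih (fun j hj ↦ hn j (by omega)) hz)
    have hwm := hu.mem_of_mul_mem_sq (hn n n.lt_succ_self) hw hz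
    obtain ⟨v, hv, rfl⟩ := Ideal.mem_span_singleton_mul.1 (h.maximalIdeal_mul_le hx hm hwm)
    exact Ideal.mem_span_singleton_mul.2 ⟨v, hv, by ring⟩

theorem le_total (hx : IsLeftRegular x)
    (hm : maximalIdeal R ^ 2 = Ideal.span {x} * maximalIdeal R) {J : Ideal R} {b : R}
    (hI : IsUlrichPair I a) (hJ : IsUlrichPair J b) (hxI : ∃ n, x ^ n ∈ I)
    (hxJ : ∃ n, x ^ n ∈ J) : I ≤ J ∨ J ≤ I := by
  classical
  wlog hle : Nat.find hxI ≤ Nat.find hxJ generalizing I J a b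
  · exact (this hJ hI hxJ hxI (le_of_not_ge hle)).symm
  refine .inr (le_of_pow_mem_of_forall_pow_notMem hx (hI.maximalIdeal_le_sup hx hm)
    (Nat.find_spec hxI) (fun j ↦ Nat.find_min hxI)
    (hI.sq_le_span_pow_mul hx hm fun j ↦ Nat.find_min hxI)
    (hJ.sq_le_span_pow_mul hx hm fun j hj ↦ Nat.find_min hxJ (hj.trans_le hle)))

end IsUlrichPair

section FlatBaseChange

variable {R A : Type*} [CommRing R] [CommRing A] [Algebra R A] [Module.Flat R A]
  {ι : Type*} [Fintype ι]

theorem exists_eq_sum_of_sum_mul_mem_map {u : ι → R} {x : ι → A} {J : Ideal R}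
    (hx : ∑ i, x i * algebraMap R A (u i) ∈ J.map (algebraMap R A)) :
    ∃ (k : ℕ) (c : ι → Fin k → R) (y : Fin k → A),
      (∀ i, x i = ∑ j, algebraMap R A (c i j) * y j) ∧ ∀ j, ∑ i, c i j * u i ∈ J := by
  obtain ⟨t, ht, r, hr⟩ := (Submodule.mem_span_image_iff_exists_fun A).1 hx
  have hrel : ∑ i, Sum.elim u (fun j : t ↦ (j : R)) i • Sum.elim x (fun j ↦ -r j) i = 0 := by
    simp only [smul_eq_mul] at hr
    simp [Algebra.smul_def, mul_comm (algebraMap R A _), ← hr]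
  obtain ⟨k, c, y, hxy, hc⟩ := Module.Flat.isTrivialRelation_of_sum_smul_eq_zero
    (R := R) (M := A) hrel
  refine ⟨k, fun i ↦ c (.inl i), y, fun i ↦ by simpa [Algebra.smul_def] using hxy (.inl i),
    fun j ↦ ?_⟩
  have hsum := hc j
  simp only [Fintype.sum_sum_type, Sum.elim_inl, Sum.elim_inr] at hsum
  simp only [mul_comm (c _ j), eq_neg_of_add_eq_zero_left hsum]
  exact J.neg_mem (J.sum_mem fun i _ ↦ J.mul_mem_right _ (ht i.2))

theorem IsCotangentBasis.map {I : Ideal R} {u : ι → R} (h : IsCotangentBasis I u) :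
    IsCotangentBasis (I.map (algebraMap R A)) (algebraMap R A ∘ u) where
  span_range_eq := by rw [Set.range_comp, ← Ideal.map_span, h.span_range_eq]
  mem_of_sum_mem_sq x hx i := by
    rw [← Ideal.map_pow] at hx
    obtain ⟨k, c, y, hxy, hc⟩ := exists_eq_sum_of_sum_mul_mem_map hx
    rw [hxy i]
    exact Ideal.sum_mem _ fun j _ ↦ Ideal.mul_mem_right _ _
      (Ideal.mem_map_of_mem _ (h.mem_of_sum_mem_sq (fun i ↦ c i j) (hc j) i))

theorem isLeftRegular_algebraMap_of_flat {a : R} (ha : IsLeftRegular a) :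
    IsLeftRegular (algebraMap R A a) :=
  IsSMulRegular.of_flat (S := A) (x := a) ha

theorem IsUlrichPair.map [IsLocalRing R] [IsLocalRing A] [IsLocalHom (algebraMap R A)]
    {I : Ideal R} {a : R} (h : IsUlrichPair I a) :
    IsUlrichPair (I.map (algebraMap R A)) (algebraMap R A a) where
  le_maximalIdeal := (Ideal.map_mono h.le_maximalIdeal).trans
    (((local_hom_TFAE (algebraMap R A)).out 0 2).1 ‹_›)
  isLeftRegular := isLeftRegular_algebraMap_of_flat h.isLeftRegular
  mem := Ideal.mem_map_of_mem _ h.mem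
  ne_span heq := by
    have := Module.FaithfullyFlat.of_flat_of_isLocalHom (A := R) (B := A)
    refine h.ne_span ?_
    rw [← Ideal.comap_map_eq_self_of_faithfullyFlat (B := A) I, heq, ← Set.image_singleton,
      ← Ideal.map_span, Ideal.comap_map_eq_self_of_faithfullyFlat]
  sq_eq := by
    rw [← Ideal.map_pow, h.sq_eq, Ideal.map_mul, Ideal.map_span, Set.image_singleton]
  exists_isCotangentBasis :=
    let ⟨n, u, hu⟩ := h.exists_isCotangentBasis
    ⟨n, _, hu.map⟩

end FlatBaseChange

theorem isLeftRegular_of_pow_mem_span {R : Type*} [CommRing R] {y a : R} (hy : IsLeftRegular y)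
    {k : ℕ} (h : y ^ k ∈ Ideal.span {a}) : IsLeftRegular a := by
  obtain ⟨c, hc⟩ := Ideal.mem_span_singleton'.1 h
  exact (hc ▸ hy.pow k).of_mul

section Ulrich

variable {R : Type*} [CommRing R] [IsLocalRing R] {I : Ideal R}

theorem span_range_eq_of_forall_toCotangent_eq_sum {ι : Type*} [Fintype ι] (hfg : I.FG)
    (hI : I ≤ maximalIdeal R) {v : ι → I}
    (hv : ∀ z : I, ∃ r : ι → R, I.toCotangent z = ∑ i, r i • I.toCotangent (v i)) :
    Ideal.span (Set.range fun i ↦ (v i : R)) = I := by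
  refine le_antisymm (Ideal.span_le.2 (by rintro _ ⟨i, rfl⟩; exact (v i).2)) ?_
  refine Submodule.le_of_le_smul_of_le_jacobson_bot (I := I) hfg
    (by rwa [jacobson_eq_maximalIdeal _ bot_ne_top]) fun z hz ↦ ?_
  obtain ⟨r, hr⟩ := hv ⟨z, hz⟩
  simp only [← map_smul, ← map_sum, Ideal.toCotangent_eq] at hr
  rw [← add_sub_cancel (∑ i, r i * (v i : R)) z]
  refine Submodule.add_mem_sup (Ideal.sum_mem _ fun i _ ↦
    Ideal.mul_mem_left _ _ (Ideal.subset_span ⟨i, rfl⟩)) ?_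
  simpa [sq] using hr

theorem exists_isCotangentBasis_of_free (hfg : I.FG) (hI : I ≤ maximalIdeal R)
    [Module.Free (R ⧸ I) I.Cotangent] : ∃ (n : ℕ) (u : Fin n → R), IsCotangentBasis I u := by
  have : Nontrivial (R ⧸ I) := Ideal.Quotient.nontrivial_iff.2 (ne_top_of_le_ne_top
    (maximalIdeal.isMaximal R).ne_top hI)
  have : Module.Finite R I := .of_fg hfg
  have : Module.Finite R I.Cotangent := .of_surjective _ I.toCotangent_surjective
  have : Module.Finite (R ⧸ I) I.Cotangent := .of_restrictScalars_finite R _ _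
  let b := Module.finBasis (R ⧸ I) I.Cotangent
  choose v hv using fun i ↦ I.toCotangent_surjective (b i)
  refine ⟨_, fun i ↦ v i, span_range_eq_of_forall_toCotangent_eq_sum hfg hI fun z ↦ ?_, ?_⟩
  · choose r hr using fun i ↦ Ideal.Quotient.mk_surjective (b.repr (I.toCotangent z) i)
    refine ⟨r, ?_⟩
    rw [← b.sum_repr (I.toCotangent z)]
    exact Finset.sum_congr rfl fun i _ ↦ by rw [hv, ← hr]; rfl
  · intro r hr i
    have hsum : ∑ i, Ideal.Quotient.mk I (r i) • b i = 0 := by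
      have hmem : I.toCotangent (∑ i, r i • v i) = 0 :=
        (I.toCotangent_eq_zero _).2 (by simpa using hr)
      simp only [map_sum, map_smul, hv] at hmem
      exact hmem
    exact Ideal.Quotient.eq_zero_iff_mem.1
      (Fintype.linearIndependent_iff.1 b.linearIndependent _ hsum i)

theorem exists_isUlrichPair_of_isUlrich [IsNoetherianRing R] (hdim : ringKrullDim R = 1) {y : R}
    (hy : y ∈ maximalIdeal R) (hreg : IsLeftRegular y) (hI : I.IsUlrich) :
    ∃ a, IsUlrichPair I a := by
  obtain ⟨hprim, ⟨Q, ⟨hQprim, d, q, hd, hQ⟩, ⟨hQI, -⟩, hne, hsq⟩, hfree⟩ := hI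
  obtain rfl : d = 1 := by exact_mod_cast hd.symm.trans hdim
  obtain rfl : Q = Ideal.span {q 0} := by rw [hQ, Set.range_unique]; rfl
  obtain ⟨k, hk⟩ : y ∈ (Ideal.span {q 0}).radical := hQprim.symm ▸ hy
  have hIm : I ≤ maximalIdeal R := hprim ▸ Ideal.le_radical
  exact ⟨q 0, hIm, isLeftRegular_of_pow_mem_span hreg hk,
    hQI (Ideal.mem_span_singleton_self _), hne, hsq,
    exists_isCotangentBasis_of_free I.fg_of_isNoetherianRing hIm⟩

theorem exists_isLeftRegular_mem_maximalIdeal (hCM : IsCohenMacaulayLocal R)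
    (hdim : ringKrullDim R = 1) : ∃ y ∈ maximalIdeal R, IsLeftRegular y := by
  obtain ⟨-, rs, hrs, hlen⟩ := hCM
  obtain ⟨y, rfl⟩ := List.length_eq_one_iff.1 (show rs.length = 1 by
    exact_mod_cast hlen.symm.trans hdim)
  refine ⟨y, ?_, ((RingTheory.Sequence.isRegular_cons_iff _ _ _).1 hrs).1⟩
  by_contra hu
  refine hrs.top_ne_smul ?_
  rw [Ideal.ofList_singleton, Ideal.span_singleton_eq_top.2 (notMem_maximalIdeal.1 hu)]
  simp only [smul_eq_mul, Ideal.top_mul]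

end Ulrich

section ColonFiltration

variable {R : Type*} [CommRing R] (I : Ideal R)

/-- The filtration `I ^ n ∩ (I ^ (n + 2) : I)`. -/
def colonFiltration : I.Filtration R where
  N n := I ^ n ⊓ (I ^ (n + 2)).colon (I : Set R)
  mono n := inf_le_inf (Ideal.pow_le_pow_right n.le_succ)
    (Submodule.colon_mono (Ideal.pow_le_pow_right (by omega)) le_rfl)
  smul_le n := by
    refine Submodule.smul_le.2 fun r hr z hz ↦ ⟨?_, Submodule.mem_colon.2 fun w hw ↦ ?_⟩
    · rw [pow_succ']
      exact Ideal.mul_mem_mul hr hz.1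
    · rw [smul_eq_mul, smul_eq_mul, mul_assoc, show n + 1 + 2 = n + 2 + 1 by ring, pow_succ' I]
      exact Ideal.mul_mem_mul hr (Submodule.mem_colon.1 hz.2 w hw)

theorem exists_forall_mem_pow_succ_of_forall_mul_mem [IsNoetherianRing R] :
    ∃ n₀, ∀ n ≥ n₀, ∀ z ∈ I ^ n, (∀ w ∈ I, z * w ∈ I ^ (n + 2)) → z ∈ I ^ (n + 1) := by
  have hstable : (colonFiltration I).Stable := (I.stableFiltration_stable ⊤).of_le fun n ↦ by
    simp [colonFiltration, inf_le_left]
  obtain ⟨n₀, hn₀⟩ := hstable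
  refine ⟨n₀ + 1, fun n hn z hz hzI ↦ ?_⟩
  obtain ⟨n, rfl⟩ := Nat.exists_eq_add_of_le' (Nat.one_le_of_lt hn)
  have hmem : z ∈ (colonFiltration I).N (n + 1) := ⟨hz, Submodule.mem_colon.2 hzI⟩
  rw [← hn₀ n (by omega)] at hmem
  refine Submodule.smul_le.2 (fun r hr y hy ↦ ?_) hmem
  rw [smul_eq_mul, mul_comm]
  exact Submodule.mem_colon.1 hy.2 r hr

end ColonFiltration

section Content

variable {R : Type*} [CommRing R] {I J : Ideal R} {F : R[X]}

theorem mul_mem_of_mem_contentIdeal {z w : R} (hz : ∀ i, F.coeff i * z ∈ J)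
    (hw : w ∈ F.contentIdeal) : w * z ∈ J := by
  rw [contentIdeal_def] at hw
  induction hw using Submodule.span_induction with
  | mem w hw =>
    obtain ⟨i, -, rfl⟩ := mem_coeffs_iff.1 hw
    exact hz i
  | zero => simp
  | add w w' _ _ hw hw' => exact add_mul w w' z ▸ J.add_mem hw hw'
  | smul r w _ hw => exact (mul_assoc r w z).symm ▸ J.mul_mem_left r hw

theorem coeff_mul_coeff_mem {g : R[X]} {i d : ℕ} (hFg : (F * g).coeff (i + d) ∈ J)
    (hi : ∀ l > i, ∀ j, F.coeff l * g.coeff j ∈ J)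
    (hd : ∀ l, ∀ j > d, F.coeff l * g.coeff j ∈ J) : F.coeff i * g.coeff d ∈ J := by
  have hmem : (i, d) ∈ Finset.HasAntidiagonal.antidiagonal (i + d) :=
    Finset.HasAntidiagonal.mem_antidiagonal.2 rfl
  rw [coeff_mul, ← Finset.add_sum_erase _ _ hmem] at hFg
  refine (J.add_mem_iff_left (J.sum_mem fun p hp ↦ ?_)).1 hFg
  obtain ⟨hne, hp⟩ := Finset.mem_erase.1 hp
  rw [Finset.HasAntidiagonal.mem_antidiagonal] at hp
  rcases lt_trichotomy p.1 i with hlt | heq | hgt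
  · exact hd _ _ (by omega)
  · exact absurd (Prod.ext heq (by omega)) hne
  · exact hi _ hgt _

-- McCoy's trick: a product `F i * g` has smaller degree than `g` modulo `I ^ (n + 2)` and is again
-- killed by `F`, so it vanishes by induction; this is applied to the coefficients of `F` from the
-- top down.
theorem coeff_mem_pow_succ_of_coeff_mul_mem {n₀ : ℕ}
    (hI : ∀ n ≥ n₀, ∀ z ∈ I ^ n, (∀ w ∈ I, z * w ∈ I ^ (n + 2)) → z ∈ I ^ (n + 1))
    (hF : F.contentIdeal = I) (d : ℕ) {n : ℕ} (hn : n₀ ≤ n) {g : R[X]}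
    (hg : ∀ j, g.coeff j ∈ I ^ n) (hd : ∀ j ≥ d, g.coeff j ∈ I ^ (n + 1))
    (hFg : ∀ j, (F * g).coeff j ∈ I ^ (n + 2)) (j : ℕ) : g.coeff j ∈ I ^ (n + 1) := by
  induction d generalizing n g j with
  | zero => exact hd j j.zero_le
  | succ d ih =>
    have hmul {k : ℕ} (i : ℕ) {z : R} (hz : z ∈ I ^ k) : F.coeff i * z ∈ I ^ (k + 1) :=
      pow_succ' I k ▸ Ideal.mul_mem_mul (hF.le (coeff_mem_contentIdeal F i)) hz
    have hcoeff (k : ℕ) : ∀ i, F.natDegree < i + k → ∀ j, F.coeff i * g.coeff j ∈ I ^ (n + 2) := by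
      induction k with
      | zero =>
        intro i hi j
        simp [coeff_eq_zero_of_natDegree_lt (show F.natDegree < i from hi)]
      | succ k ihk =>
        intro i hi
        have hlead : F.coeff i * g.coeff d ∈ I ^ (n + 2) :=
          coeff_mul_coeff_mem (hFg (i + d)) (fun l hl ↦ ihk l (by omega))
            fun l j hj ↦ hmul l (hd j hj)
        have hind := ih (n := n + 1) (g := C (F.coeff i) * g) (by omega)
          (fun j ↦ by simpa only [coeff_C_mul] using hmul i (hg j))
          (fun j hj ↦ by
            rw [coeff_C_mul]
            obtain rfl | hlt := hj.eq_or_lt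
            · exact hlead
            · exact hmul i (hd j hlt))
          (fun j ↦ by simpa only [mul_left_comm F, coeff_C_mul] using hmul i (hFg j))
        simpa only [coeff_C_mul] using hind
    refine hI n hn _ (hg j) fun w hw ↦ ?_
    rw [mul_comm]
    exact mul_mem_of_mem_contentIdeal (fun i ↦ hcoeff (F.natDegree + 1) i (by omega) j) (hF ▸ hw)

theorem exists_forall_mem_map_C_pow_succ [IsNoetherianRing R] (hF : F.contentIdeal = I) :
    ∃ n₀, ∀ n ≥ n₀, ∀ g ∈ (I ^ n).map C, F * g ∈ (I ^ (n + 2)).map C → g ∈ (I ^ (n + 1)).map C := by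
  obtain ⟨n₀, hI⟩ := exists_forall_mem_pow_succ_of_forall_mul_mem I
  refine ⟨n₀, fun n hn g hg hFg ↦ ?_⟩
  rw [Ideal.mem_map_C_iff] at hg hFg ⊢
  refine coeff_mem_pow_succ_of_coeff_mul_mem hI hF (g.natDegree + 1) hn hg (fun j hj ↦ ?_) hFg
  rw [coeff_eq_zero_of_natDegree_lt hj]
  exact zero_mem _

theorem mem_map_C_of_mul_mem_map_C {t g : R[X]} (ht : t.contentIdeal = ⊤)
    (htg : t * g ∈ I.map C) : g ∈ I.map C := by
  rw [← Ideal.mk_ker (I := I), ← ker_mapRingHom, RingHom.mem_ker, coe_mapRingHom] at htg ⊢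
  rw [Polynomial.map_mul] at htg
  have hreg : t.map (Ideal.Quotient.mk I) ∈ nonZeroDivisors (R ⧸ I)[X] := by
    have htop : (t.map (Ideal.Quotient.mk I)).contentIdeal = ⊤ := by
      rw [contentIdeal_map_eq_map_contentIdeal, ht, Ideal.map_top]
    refine Polynomial.mem_nonZeroDivisors_iff.2 fun a ha ↦ ?_
    have hmem : 1 * a ∈ (⊥ : Ideal (R ⧸ I)) := by
      refine mul_mem_of_mem_contentIdeal (fun i ↦ ?_) (htop ▸ Submodule.mem_top)
      simpa [mul_comm] using congr_arg (coeff · i) ha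
    simpa using hmem
  exact (mul_left_mem_nonZeroDivisors_eq_zero_iff hreg).1 htg

theorem exists_contentIdeal_eq (hI : I.FG) : ∃ F : R[X], F.contentIdeal = I := by
  obtain ⟨n, u, rfl⟩ := Submodule.fg_iff_exists_fin_generating_family.1 hI
  refine ⟨∑ i : Fin n, monomial i (u i), le_antisymm ?_ (Submodule.span_le.2 ?_)⟩
  · rw [contentIdeal_def, Ideal.span_le]
    intro c hc
    obtain ⟨i, -, rfl⟩ := mem_coeffs_iff.1 hc
    rw [finsetSum_coeff]
    refine Submodule.sum_mem _ fun j _ ↦ ?_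
    rw [coeff_monomial]
    split_ifs
    · exact Submodule.subset_span ⟨j, rfl⟩
    · exact zero_mem _
  · rintro _ ⟨i, rfl⟩
    have hcoeff : (∑ j : Fin n, monomial j (u j)).coeff i = u i := by
      simp [finsetSum_coeff, coeff_monomial, Fin.val_inj]
    exact hcoeff ▸ coeff_mem_contentIdeal _ _

end Content

/-- An element `f ∈ I` is superficial for `I` if multiplication by its class, of degree one in the
associated graded ring of `I`, is injective in all large degrees. -/
def IsSuperficial {R : Type*} [CommRing R] (I : Ideal R) (f : R) : Prop :=
  f ∈ I ∧ ∃ n₀, ∀ n ≥ n₀, ∀ z ∈ I ^ n, f * z ∈ I ^ (n + 2) → z ∈ I ^ (n + 1)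

section NagataRing

variable (R : Type*) [CommRing R] [IsLocalRing R]

/-- The Nagata ring `R(X)`: the localization of `R[X]` at the extension of the maximal ideal. It is
used to enlarge the residue field, so that superficial elements exist. -/
abbrev NagataRing : Type _ := Localization.AtPrime ((maximalIdeal R).map (C : R →+* R[X]))

instance : Module.Flat R (NagataRing R) := .trans R R[X] _

theorem map_maximalIdeal_nagataRing :
    (maximalIdeal R).map (algebraMap R (NagataRing R)) = maximalIdeal (NagataRing R) := by
  rw [IsScalarTower.algebraMap_eq R R[X] (NagataRing R), ← Ideal.map_map]
  exact Localization.AtPrime.map_eq_maximalIdeal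

instance : IsLocalHom (algebraMap R (NagataRing R)) :=
  ((local_hom_TFAE _).out 0 2).2 (map_maximalIdeal_nagataRing R).le

instance [IsNoetherianRing R] : IsNoetherianRing (NagataRing R) :=
  IsLocalization.isNoetherianRing ((maximalIdeal R).map (C : R →+* R[X])).primeCompl _ inferInstance

variable {R}

theorem contentIdeal_eq_top_of_notMem_map_C {t : R[X]} (ht : t ∉ (maximalIdeal R).map C) :
    t.contentIdeal = ⊤ := by
  by_contra hne
  exact ht (Ideal.mem_map_C_iff.2 fun i ↦ le_maximalIdeal hne (coeff_mem_contentIdeal t i))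

theorem algebraMap_mem_map_nagataRing_iff {J : Ideal R} {g : R[X]} :
    algebraMap R[X] (NagataRing R) g ∈ J.map (algebraMap R (NagataRing R)) ↔ g ∈ J.map C := by
  rw [IsScalarTower.algebraMap_eq R R[X] (NagataRing R), ← Ideal.map_map]
  refine ⟨fun h ↦ ?_, Ideal.mem_map_of_mem _⟩
  obtain ⟨t, ht, htg⟩ := (IsLocalization.algebraMap_mem_map_algebraMap_iff
    ((maximalIdeal R).map (C : R →+* R[X])).primeCompl _ _ _).1 h
  exact mem_map_C_of_mul_mem_map_C (contentIdeal_eq_top_of_notMem_map_C ht) htg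

theorem exists_isSuperficial_nagataRing [IsNoetherianRing R] :
    ∃ f, IsSuperficial (maximalIdeal (NagataRing R)) f := by
  obtain ⟨F, hF⟩ := exists_contentIdeal_eq (maximalIdeal R).fg_of_isNoetherianRing
  obtain ⟨n₀, hn₀⟩ := exists_forall_mem_map_C_pow_succ hF
  refine ⟨algebraMap R[X] _ F, ?_, n₀, fun n hn z hz hFz ↦ ?_⟩
  · rw [← map_maximalIdeal_nagataRing, algebraMap_mem_map_nagataRing_iff, Ideal.mem_map_C_iff]
    exact fun i ↦ hF.le (coeff_mem_contentIdeal F i)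
  · rw [← map_maximalIdeal_nagataRing, ← Ideal.map_pow] at hz hFz ⊢
    obtain ⟨⟨g, s⟩, hgs⟩ := IsLocalization.surj
      ((maximalIdeal R).map (C : R →+* R[X])).primeCompl z
    have hunit := IsLocalization.map_units (NagataRing R) s
    rw [← Ideal.mul_unit_mem_iff_mem _ hunit, hgs, algebraMap_mem_map_nagataRing_iff]
    refine hn₀ n hn g ?_ ?_
    · rw [← algebraMap_mem_map_nagataRing_iff, ← hgs]
      exact Ideal.mul_mem_right _ _ hz
    · rw [← algebraMap_mem_map_nagataRing_iff, map_mul, ← hgs, ← mul_assoc]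
      exact Ideal.mul_mem_right _ _ hFz

end NagataRing

section Length

variable {R : Type*} [CommRing R]

theorem surjective_of_injective_of_length_le {M N : Type*} [AddCommGroup M] [Module R M]
    [AddCommGroup N] [Module R N] {φ : M →ₗ[R] N} (hφ : Function.Injective φ)
    (hle : Module.length R N ≤ Module.length R M) (hfin : Module.length R M ≠ ⊤) :
    Function.Surjective φ := by
  have hadd := Module.length_eq_add_of_exact φ φ.range.mkQ hφ (Submodule.mkQ_surjective _)
    (LinearMap.exact_map_mkQ_range φ)
  rw [← LinearMap.range_eq_top, ← Submodule.Quotient.subsingleton_iff,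
    ← Module.length_eq_zero_iff (R := R)]
  refine (add_right_inj_of_ne_top hfin).1 ?_
  rw [add_zero]
  exact le_antisymm (hadd ▸ hle) le_self_add

theorem eq_of_le_of_length_quotient_le {M : Type*} [AddCommGroup M] [Module R M]
    {N P : Submodule R M} (hNP : N ≤ P)
    (hle : Module.length R (M ⧸ N) ≤ Module.length R (M ⧸ P))
    (hfin : Module.length R (M ⧸ P) ≠ ⊤) : N = P := by
  have hadd := Module.length_eq_add_of_exact (LinearMap.ker (Submodule.factor hNP)).subtype
    (Submodule.factor hNP) (Submodule.subtype_injective _) (Submodule.factor_surjective hNP)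
    (LinearMap.exact_subtype_ker_map _)
  have hker : Module.length R (LinearMap.ker (Submodule.factor hNP)) = 0 := by
    refine (add_left_inj_of_ne_top hfin).1 ?_
    rw [zero_add, ← hadd]
    exact le_antisymm hle (hadd ▸ le_add_self)
  rw [Module.length_eq_zero_iff, Submodule.subsingleton_iff_eq_bot, LinearMap.ker_eq_bot] at hker
  refine le_antisymm hNP fun z hz ↦ ?_
  rw [← Submodule.Quotient.mk_eq_zero] at hz ⊢
  exact hker (hz.trans (map_zero _).symm)

theorem length_quotient_span_singleton_mul {f : R} (hf : IsLeftRegular f) (I : Ideal R) :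
    Module.length R (R ⧸ Ideal.span {f} * I) =
      Module.length R (R ⧸ I) + Module.length R (R ⧸ Ideal.span {f}) := by
  have hadd := Module.length_eq_add_of_exact _ _
    (I.mulQuot_injective (isRegular_iff_mem_nonZeroDivisors.1 (isLeftRegular_iff_isRegular.1 hf)))
    I.quotOfMul_surjective I.exact_mulQuot_quotOfMul
  rwa [← Submodule.ideal_span_singleton_smul] at hadd

theorem mem_smul_top_iff_coe_mem_mul {I N : Ideal R} {z : N} :
    z ∈ I • (⊤ : Submodule R N) ↔ (z : R) ∈ I * N := by
  rw [← Submodule.comap_map_eq_of_injective N.subtype_injective (I • ⊤), Submodule.mem_comap,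
    Submodule.map_smul'', Submodule.map_top, Submodule.range_subtype, smul_eq_mul,
    Submodule.subtype_apply]

theorem length_quotient_mul (I N : Ideal R) :
    Module.length R (R ⧸ I * N) =
      Module.length R (N ⧸ I • (⊤ : Submodule R N)) + Module.length R (R ⧸ N) := by
  have hcomap : I • (⊤ : Submodule R N) = Submodule.comap N.subtype (I * N) :=
    SetLike.ext fun _ ↦ mem_smul_top_iff_coe_mem_mul
  refine Module.length_eq_add_of_exact
    (Submodule.mapQ (I • (⊤ : Submodule R N)) (I * N) N.subtype hcomap.le)
    (Submodule.factor Ideal.mul_le_right) ?_ (Submodule.factor_surjective _) ?_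
  · rw [← LinearMap.ker_eq_bot, Submodule.ker_mapQ, ← hcomap, Submodule.mkQ_map_self]
  · rw [LinearMap.exact_iff, Submodule.range_mapQ, Submodule.range_subtype, Submodule.factor,
      Submodule.ker_mapQ, Submodule.comap_id]

end Length

section HilbertFunction

variable {R : Type*} [CommRing R] [IsLocalRing R]

theorem length_quotient_maximalIdeal_smul_top {N : Ideal R} (hN : N.FG) :
    Module.length R (N ⧸ maximalIdeal R • (⊤ : Submodule R N)) = N.spanFinrank := by
  let _ := Ideal.Quotient.field (maximalIdeal R)
  have : Module.Finite R N := .of_fg hN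
  rw [IsLocalRing.spanFinrank_eq_finrank_quotient N hN, Module.length_eq_of_surjective
    (R := R ⧸ maximalIdeal R) (S := R) Ideal.Quotient.mk_surjective, Module.length_eq_finrank]

theorem length_quotient_maximalIdeal_mul {N : Ideal R} (hN : N.FG) :
    Module.length R (R ⧸ maximalIdeal R * N) = N.spanFinrank + Module.length R (R ⧸ N) := by
  rw [length_quotient_mul, length_quotient_maximalIdeal_smul_top hN]

theorem length_quotient_maximalIdeal_pow (hfg : (maximalIdeal R).FG) (n : ℕ) :
    Module.length R (R ⧸ maximalIdeal R ^ n) =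
      ((∑ i ∈ Finset.range n, (maximalIdeal R ^ i).spanFinrank : ℕ) : ℕ∞) := by
  induction n with
  | zero =>
    rw [pow_zero, Ideal.one_eq_top, Finset.range_zero, Finset.sum_empty, Nat.cast_zero,
      Module.length_eq_zero_iff]
    infer_instance
  | succ n ih =>
    rw [pow_succ', length_quotient_maximalIdeal_mul hfg.pow, ih, Finset.sum_range_succ,
      Nat.cast_add, add_comm]

section Multiplication

variable {N M : Ideal R} {f : R}

/-- Multiplication by `f`, as a map `N / 𝔪 N → M / 𝔪 M`. -/
def mulQuotientMaximalIdeal (hf : ∀ z ∈ N, f * z ∈ M) :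
    (N ⧸ maximalIdeal R • (⊤ : Submodule R N)) →ₗ[R] M ⧸ maximalIdeal R • (⊤ : Submodule R M) :=
  Submodule.mapQ _ _ ((LinearMap.mulLeft R f).restrict hf)
    (Submodule.smul_top_le_comap_smul_top _ _)

theorem mulQuotientMaximalIdeal_injective (hf : ∀ z ∈ N, f * z ∈ M)
    (hinj : ∀ z ∈ N, f * z ∈ maximalIdeal R * M → z ∈ maximalIdeal R * N) :
    Function.Injective (mulQuotientMaximalIdeal hf) := by
  rw [← LinearMap.ker_eq_bot, mulQuotientMaximalIdeal, Submodule.ker_mapQ, eq_bot_iff,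
    Submodule.map_le_iff_le_comap, Submodule.comap_bot, Submodule.ker_mkQ]
  exact fun z hz ↦ mem_smul_top_iff_coe_mem_mul.2
    (hinj z z.2 (mem_smul_top_iff_coe_mem_mul.1 hz))

theorem spanFinrank_le_of_forall_mul_mem (hN : N.FG) (hM : M.FG) (hf : ∀ z ∈ N, f * z ∈ M)
    (hinj : ∀ z ∈ N, f * z ∈ maximalIdeal R * M → z ∈ maximalIdeal R * N) :
    N.spanFinrank ≤ M.spanFinrank := by
  have hle := Module.length_le_of_injective _ (mulQuotientMaximalIdeal_injective hf hinj)
  rw [length_quotient_maximalIdeal_smul_top hN, length_quotient_maximalIdeal_smul_top hM] at hle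
  exact_mod_cast hle

theorem eq_span_singleton_mul_of_spanFinrank_eq (hN : N.FG) (hM : M.FG) (hf : ∀ z ∈ N, f * z ∈ M)
    (hinj : ∀ z ∈ N, f * z ∈ maximalIdeal R * M → z ∈ maximalIdeal R * N)
    (heq : N.spanFinrank = M.spanFinrank) : M = Ideal.span {f} * N := by
  have hsurj := surjective_of_injective_of_length_le (mulQuotientMaximalIdeal_injective hf hinj)
    (by rw [length_quotient_maximalIdeal_smul_top hN, length_quotient_maximalIdeal_smul_top hM,
      heq])
    (by rw [length_quotient_maximalIdeal_smul_top hN]; exact ENat.natCast_ne_top _)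
  refine le_antisymm (Submodule.le_of_le_smul_of_le_jacobson_bot hM
    (maximalIdeal_le_jacobson ⊥) fun m hm ↦ ?_) (Ideal.span_singleton_mul_le_iff.2 hf)
  obtain ⟨q, hq⟩ := hsurj (Submodule.Quotient.mk ⟨m, hm⟩)
  obtain ⟨z, rfl⟩ := Submodule.Quotient.mk_surjective _ q
  rw [mulQuotientMaximalIdeal, Submodule.mapQ_apply, eq_comm, Submodule.Quotient.eq,
    mem_smul_top_iff_coe_mem_mul] at hq
  exact Submodule.mem_sup.2 ⟨f * z, Ideal.mul_mem_mul (Ideal.mem_span_singleton_self f) z.2,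
    _, hq, add_sub_cancel _ _⟩

end Multiplication

end HilbertFunction

section Multiplicity

theorem eventually_eq_of_monotone_of_tendsto_average {h : ℕ → ℕ} {n₀ v : ℕ}
    (hmono : ∀ n ≥ n₀, h n ≤ h (n + 1))
    (hlim : Tendsto (fun n : ℕ ↦ ((∑ i ∈ Finset.range n, h i : ℕ) : ℝ) / n) atTop (nhds v)) :
    ∀ᶠ n in atTop, h n = v := by
  have havg : Tendsto (fun n : ℕ ↦ (n : ℝ)⁻¹ * ∑ i ∈ Finset.range n, (h i : ℝ)) atTop (nhds v) :=
    hlim.congr fun n ↦ by rw [Nat.cast_sum, div_eq_inv_mul]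
  have hmono' : Monotone fun n ↦ h (n + n₀) :=
    monotone_nat_of_le_succ fun n ↦ (hmono _ (Nat.le_add_left _ _)).trans_eq (by congr 1; ring)
  rcases tendsto_atTop_of_monotone hmono' with htop | ⟨l, hl⟩
  · rw [tendsto_add_atTop_iff_nat] at htop
    have hmin : Tendsto (fun n ↦ ((min (h n) (v + 1) : ℕ) : ℝ)) atTop (nhds ((v + 1 : ℕ) : ℝ)) :=
      tendsto_const_nhds.congr' ((htop.eventually_ge_atTop (v + 1)).mono fun n hn ↦ by
        simp only [min_eq_right hn])
    have hle := le_of_tendsto_of_tendsto' hmin.cesaro havg fun n ↦ by gcongr; exact min_le_left _ _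
    exact absurd (Nat.cast_le.1 hle) (by omega)
  · rw [tendsto_add_atTop_iff_nat] at hl
    have hcesaro :=
      ((continuous_of_discreteTopology (f := ((↑) : ℕ → ℝ))).tendsto l |>.comp hl).cesaro
    have : l = v := Nat.cast_injective (tendsto_nhds_unique hcesaro havg)
    exact this ▸ tendsto_pure.1 (nhds_discrete ℕ ▸ hl)

end Multiplicity

section FlatLocalBaseChange

variable {R A : Type*} [CommRing R] [CommRing A] [Algebra R A] [Module.Flat R A]

theorem nonempty_tensorProduct_linearEquiv_map (N : Ideal R) :
    Nonempty (A ⊗[R] N ≃ₗ[A] N.map (algebraMap R A)) := by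
  let φ : A ⊗[R] N →ₗ[A] A := (AlgebraTensorModule.rid R A A).toLinearMap ∘ₗ N.subtype.baseChange A
  have hφ : Function.Injective φ := (AlgebraTensorModule.rid R A A).injective.comp
    (Module.Flat.lTensor_preserves_injective_linearMap _ N.subtype_injective)
  have hrange : LinearMap.range φ = N.map (algebraMap R A) := by
    rw [LinearMap.range_comp, ← Submodule.baseChange, Submodule.baseChange_eq_span,
      Submodule.map_span, Ideal.map, Submodule.map_coe, Set.image_image]
    simp [Algebra.smul_def]
  exact ⟨.ofInjective φ hφ ≪≫ₗ .ofEq _ _ hrange⟩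

variable [IsLocalRing R] [IsLocalRing A] [IsLocalHom (algebraMap R A)]

theorem spanFinrank_map_of_flat {N : Ideal R} (hN : N.FG) :
    (N.map (algebraMap R A)).spanFinrank = N.spanFinrank := by
  obtain ⟨e⟩ := nonempty_tensorProduct_linearEquiv_map (A := A) N
  have : Module.Finite R N := .of_fg hN
  have hbase : Module.finrank (ResidueField A) (ResidueField A ⊗[A] N.map (algebraMap R A)) =
      Module.finrank (ResidueField R) (ResidueField R ⊗[R] N) := calc
    _ = Module.finrank (ResidueField A) (ResidueField A ⊗[A] (A ⊗[R] N)) :=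
      (AlgebraTensorModule.congr (.refl _ _) e.symm).finrank_eq
    _ = Module.finrank (ResidueField A) (ResidueField A ⊗[R] N) :=
      (AlgebraTensorModule.cancelBaseChange R A (ResidueField A) (ResidueField A) N).finrank_eq
    _ = Module.finrank (ResidueField A)
          (ResidueField A ⊗[ResidueField R] (ResidueField R ⊗[R] N)) :=
      (AlgebraTensorModule.cancelBaseChange R (ResidueField R) (ResidueField A)
        (ResidueField A) N).symm.finrank_eq
    _ = _ := Module.finrank_baseChange
  have hmap : (N.map (algebraMap R A)).FG := Ideal.FG.map hN _
  rw [← TensorProduct.spanFinrank_top_eq_of_residueField _ hN,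
    ← TensorProduct.spanFinrank_top_eq_of_residueField (N.map (algebraMap R A)) hmap,
    ← Module.finrank_eq_spanFinrank_of_free, ← Module.finrank_eq_spanFinrank_of_free, hbase]

end FlatLocalBaseChange

section MinimalMultiplicity

variable {R : Type*} [CommRing R] [IsLocalRing R]

theorem hasMultiplicity_maximalIdeal_iff (hfg : (maximalIdeal R).FG) {e : ℝ} :
    (maximalIdeal R).HasMultiplicity e ↔
      Tendsto (fun n : ℕ ↦
        ((∑ i ∈ Finset.range n, (maximalIdeal R ^ i).spanFinrank : ℕ) : ℝ) / n) atTop (nhds e) := by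
  simp only [Ideal.HasMultiplicity, length_quotient_maximalIdeal_pow hfg, ENat.toNat_natCast]

theorem hasMultiplicity_embeddingDim_of_flat {A : Type*} [CommRing A] [IsLocalRing A]
    [Algebra R A] [Module.Flat R A] [IsLocalHom (algebraMap R A)]
    (hmax : (maximalIdeal R).map (algebraMap R A) = maximalIdeal A) (hfg : (maximalIdeal R).FG)
    (h : (maximalIdeal R).HasMultiplicity (embeddingDim R)) :
    (maximalIdeal A).HasMultiplicity (embeddingDim A) := by
  rw [hasMultiplicity_maximalIdeal_iff (hmax ▸ hfg.map _)]
  simp only [embeddingDim, ← hmax, ← Ideal.map_pow, spanFinrank_map_of_flat hfg.pow,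
    spanFinrank_map_of_flat hfg]
  exact (hasMultiplicity_maximalIdeal_iff hfg).1 h

variable {f : R}

theorem IsSuperficial.exists_pow_succ_eq (hf : IsSuperficial (maximalIdeal R) f)
    (hfg : (maximalIdeal R).FG) {v : ℕ} (hv : (maximalIdeal R).HasMultiplicity v) :
    ∃ n, (maximalIdeal R ^ n).spanFinrank = v ∧
      maximalIdeal R ^ (n + 1) = Ideal.span {f} * maximalIdeal R ^ n := by
  obtain ⟨hfm, n₀, hn₀⟩ := hf
  have hmul (n : ℕ) : ∀ z ∈ maximalIdeal R ^ n, f * z ∈ maximalIdeal R ^ (n + 1) := fun z hz ↦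
    pow_succ' (maximalIdeal R) n ▸ Ideal.mul_mem_mul hfm hz
  have hinj (n : ℕ) (hn : n₀ ≤ n) : ∀ z ∈ maximalIdeal R ^ n,
      f * z ∈ maximalIdeal R * maximalIdeal R ^ (n + 1) →
        z ∈ maximalIdeal R * maximalIdeal R ^ n := by
    simpa only [← pow_succ'] using hn₀ n hn
  have hev := eventually_eq_of_monotone_of_tendsto_average
    (fun n hn ↦ spanFinrank_le_of_forall_mul_mem hfg.pow hfg.pow (hmul n) (hinj n hn))
    ((hasMultiplicity_maximalIdeal_iff hfg).1 hv)
  obtain ⟨n, ⟨hn, hn'⟩, hge⟩ :=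
    ((hev.and ((tendsto_add_atTop_nat 1).eventually hev)).and (eventually_ge_atTop n₀)).exists
  exact ⟨n, hn, eq_span_singleton_mul_of_spanFinrank_eq hfg.pow hfg.pow (hmul n) (hinj n hge)
    (hn.trans hn'.symm)⟩

theorem sq_maximalIdeal_eq_span_singleton_mul (hfg : (maximalIdeal R).FG) (hf : IsLeftRegular f)
    (hfm : f ∈ maximalIdeal R) {n : ℕ}
    (hn : maximalIdeal R ^ (n + 1) = Ideal.span {f} * maximalIdeal R ^ n)
    (hv : (maximalIdeal R ^ n).spanFinrank = (maximalIdeal R).spanFinrank) :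
    maximalIdeal R ^ 2 = Ideal.span {f} * maximalIdeal R := by
  have hfin (k : ℕ) : Module.length R (R ⧸ maximalIdeal R ^ k) ≠ ⊤ := by
    rw [length_quotient_maximalIdeal_pow hfg]
    exact ENat.natCast_ne_top _
  have hlen : Module.length R (R ⧸ Ideal.span {f}) = (maximalIdeal R).spanFinrank := by
    rw [← add_right_inj_of_ne_top (hfin n), ← length_quotient_span_singleton_mul hf, ← hn,
      pow_succ', length_quotient_maximalIdeal_mul hfg.pow, hv, add_comm]
  refine (eq_of_le_of_length_quotient_le ?_ (le_of_eq ?_) (hfin 2)).symm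
  · exact sq (maximalIdeal R) ▸ Ideal.mul_mono_left
      ((Ideal.span_singleton_le_iff_mem _).2 hfm)
  · rw [length_quotient_span_singleton_mul hf, sq, length_quotient_maximalIdeal_mul hfg, hlen,
      add_comm]

theorem IsSuperficial.isLeftRegular_and_sq_maximalIdeal_eq
    (hf : IsSuperficial (maximalIdeal R) f) (hfg : (maximalIdeal R).FG)
    (hmult : (maximalIdeal R).HasMultiplicity (embeddingDim R)) {y : R} (hy : y ∈ maximalIdeal R)
    (hreg : IsLeftRegular y) :
    IsLeftRegular f ∧ maximalIdeal R ^ 2 = Ideal.span {f} * maximalIdeal R := by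
  obtain ⟨n, hv, hn⟩ := hf.exists_pow_succ_eq hfg hmult
  have hfreg : IsLeftRegular f := isLeftRegular_of_pow_mem_span hreg
    (Ideal.mul_le_left (hn.le (Ideal.pow_mem_pow hy _)))
  exact ⟨hfreg, sq_maximalIdeal_eq_span_singleton_mul hfg hfreg hf.1 hn hv⟩

end MinimalMultiplicity

theorem exists_pow_mem_map_of_isMPrimary {R A : Type*} [CommRing R] [IsLocalRing R]
    [IsNoetherianRing R] [CommRing A] [IsLocalRing A] [Algebra R A]
    (hmax : (maximalIdeal R).map (algebraMap R A) = maximalIdeal A) {I : Ideal R}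
    (hI : I.IsMPrimary) {f : A} (hf : f ∈ maximalIdeal A) :
    ∃ n, f ^ n ∈ I.map (algebraMap R A) := by
  obtain ⟨n, hn⟩ := I.exists_radical_pow_le_of_fg I.radical.fg_of_isNoetherianRing
  refine ⟨n, Ideal.map_mono hn ?_⟩
  rw [hI, Ideal.map_pow, hmax]
  exact Ideal.pow_mem_pow hf n

theorem theorem5p3 {R : Type*} [CommRing R] [IsLocalRing R]
    (hCM : IsCohenMacaulayLocal R) (hdim : ringKrullDim R = 1)
    (e : ℝ) (he : (IsLocalRing.maximalIdeal R).HasMultiplicity e)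
    (hve : (embeddingDim R : ℝ) = e) (he1 : 1 < e) :
    IsChain (· ≤ ·) (ulrichIdeals R) := by
  have : IsNoetherianRing R := hCM.1
  have := Module.FaithfullyFlat.of_flat_of_isLocalHom (A := R) (B := NagataRing R)
  obtain ⟨y, hy, hreg⟩ := exists_isLeftRegular_mem_maximalIdeal hCM hdim
  obtain ⟨f, hf⟩ := exists_isSuperficial_nagataRing (R := R)
  have hmult := hasMultiplicity_embeddingDim_of_flat (map_maximalIdeal_nagataRing R)
    (maximalIdeal R).fg_of_isNoetherianRing (hve ▸ he)
  obtain ⟨hfreg, hsq⟩ := hf.isLeftRegular_and_sq_maximalIdeal_eq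
    (maximalIdeal (NagataRing R)).fg_of_isNoetherianRing hmult
    (map_maximalIdeal_nagataRing R ▸ Ideal.mem_map_of_mem _ hy)
    (isLeftRegular_algebraMap_of_flat hreg)
  intro I hI J hJ _
  obtain ⟨a, ha⟩ := exists_isUlrichPair_of_isUlrich hdim hy hreg hI
  obtain ⟨b, hb⟩ := exists_isUlrichPair_of_isUlrich hdim hy hreg hJ
  have hpow {K : Ideal R} (hK : K.IsUlrich) : ∃ n, f ^ n ∈ K.map (algebraMap R (NagataRing R)) :=
    exists_pow_mem_map_of_isMPrimary (map_maximalIdeal_nagataRing R) hK.1 hf.1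
  have hle {K L : Ideal R} (h : K.map (algebraMap R (NagataRing R)) ≤ L.map (algebraMap R _)) :
      K ≤ L := by
    rw [← K.comap_map_eq_self_of_faithfullyFlat (B := NagataRing R),
      ← L.comap_map_eq_self_of_faithfullyFlat (B := NagataRing R)]
    exact Ideal.comap_mono h
  exact (ha.map.le_total hfreg hsq hb.map (hpow hI) (hpow hJ)).imp hle hle
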